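/- Let $d\ge 1$, let $\mathcal X$ and $\mathcal Y$ be $d$-dimensional complex Hilbert spaces with linear operators $L(\mathcal X)$, $L(\mathcal Y)$, and let $|1\rangle,\dots,|d\rangle$ be an orthonormal basis of $\mathcal X$. A super-operator is a complex-linear map $\Phi:L(\mathcal X)\to L(\mathcal Y)$. It is trace-preserving if $\operatorname{Tr}\Phi(A)=\operatorname{Tr}A$ for all $A$, unital if $\Phi(\mathbb 1_{\mathcal X})=\mathbb 1_{\mathcal Y}$, and doubly stochastic if it is completely positive, trace-preserving and unital. It is mixed-unitary if there are finitely many unitary operators $U_1,\dots,U_N:\mathcal X\to\mathcal Y$ and a probability vector $(p_1,\dots,p_N)$ with $\Phi(A)=\sum_{i=1}^N p_i\,U_iAU_i^{*}$ for all $A\in L(\mathcal X)$. Its Choi–Jamiołkowski representation is $$J(\Phi)=\sum_{1\le i,j\le d}\Phi(|i\rangle\langle j|)\otimes|i\rangle\langle j|\in L(\mathcal Y\otimes\mathcal X).$$ The completely depolarizing channel is $\Omega(A)=\frac{\operatorname{Tr}(A)}{d}\mathbb 1_{\mathcal Y}$, and $\|\cdot\|_\infty$ denotes the operator (spectral) norm.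 1. Let $\Phi$ be a trace-preserving and unital super-operator such that $J(\Phi)$ is Hermitian and $$\Big\|J(\Phi)-\tfrac1d\mathbb 1_{\mathcal Y\otimes\mathcal X}\Big\|_\infty\le\frac{1}{d(d^2-1)}.$$ Then $\Phi$ is mixed-unitary. (For $d=1$ the left-hand side is always $0$ and the inequality is regarded as satisfied.) 2. Consequently, within the smallest real affine subspace $\mathcal A$ of super-operators that contains all doubly stochastic channels, there is a ball of positive radius around $\Omega$ consisting of mixed-unitary channels: $\Omega\in\mathcal A$, and there is $r>0$ such that every $\Phi\in\mathcal A$ with $\|J(\Phi)-J(\Omega)\|_\infty\le r$ is mixed-unitary. -/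

import Mathlib

open scoped TensorProduct CStarAlgebra

noncomputable section

namespace QChannel

variable {X Y : Type*} [NormedAddCommGroup X] [InnerProductSpace ℂ X] [CompleteSpace X]
  [NormedAddCommGroup Y] [InnerProductSpace ℂ Y] [CompleteSpace Y]

/-- Super-operators: complex-linear maps from the operators on `X` to the operators on `Y`. For
finite-dimensional spaces `X →L[ℂ] X` consists of all linear operators on `X`. -/
abbrev SuperOp (X Y : Type*) [NormedAddCommGroup X] [InnerProductSpace ℂ X]
    [NormedAddCommGroup Y] [InnerProductSpace ℂ Y] :=
  (X →L[ℂ] X) →ₗ[ℂ] (Y →L[ℂ] Y)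

/-- The trace of an operator. -/
def tr (A : X →L[ℂ] X) : ℂ := LinearMap.trace ℂ X (A : X →ₗ[ℂ] X)

def TracePreserving (Φ : SuperOp X Y) : Prop := ∀ A, tr (Φ A) = tr A

def Unital (Φ : SuperOp X Y) : Prop := Φ 1 = 1

/-- Complete positivity, in the sense of C⋆-algebras: applying `Φ` to all the entries of a positive
`k × k` matrix of operators gives a positive matrix of operators, for every `k`. -/
def CompletelyPositive (Φ : SuperOp X Y) : Prop :=
  ∃ F : (X →L[ℂ] X) →CP (Y →L[ℂ] Y), F.toLinearMap = Φ

/-- A doubly stochastic channel: completely positive, trace-preserving and unital. -/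
def DoublyStochastic (Φ : SuperOp X Y) : Prop :=
  CompletelyPositive Φ ∧ TracePreserving Φ ∧ Unital Φ

/-- A mixed-unitary channel: `Φ(A) = ∑ i, p i • U i A (U i)⋆` for finitely many unitary operators
`U i : X → Y` and a probability vector `p`. -/
def MixedUnitary (Φ : SuperOp X Y) : Prop :=
  ∃ (N : ℕ) (U : Fin N → (X ≃ₗᵢ[ℂ] Y)) (p : Fin N → ℝ),
    (∀ i, 0 ≤ p i) ∧ ∑ i, p i = 1 ∧
    ∀ A : X →L[ℂ] X, Φ A = ∑ i, (p i : ℂ) •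
      ((U i : X →L[ℂ] Y) ∘L A ∘L ContinuousLinearMap.adjoint (U i : X →L[ℂ] Y))

/-- The completely depolarizing channel `Ω(A) = (Tr A / d) 𝟙`, where `d` is the dimension. -/
def depolarizing (X Y : Type*) [NormedAddCommGroup X] [InnerProductSpace ℂ X]
    [NormedAddCommGroup Y] [InnerProductSpace ℂ Y] : SuperOp X Y where
  toFun A := (tr A / (Module.finrank ℂ X : ℂ)) • (1 : Y →L[ℂ] Y)
  map_add' A B := by simp [tr, add_div, add_smul]
  map_smul' c A := by simp [tr, mul_div_assoc, mul_smul]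

/-- The Choi–Jamiołkowski representation `J(Φ) = ∑ i j, Φ(|i⟩⟨j|) ⊗ |i⟩⟨j|` with respect to an
orthonormal basis of `X`. -/
def choi {d : ℕ} (b : OrthonormalBasis (Fin d) ℂ X) (Φ : SuperOp X Y) :
    (Y ⊗[ℂ] X) →L[ℂ] (Y ⊗[ℂ] X) :=
  ∑ i, ∑ j, TensorProduct.mapL (Φ (InnerProductSpace.rankOne ℂ (b i) (b j)))
    (InnerProductSpace.rankOne ℂ (b i) (b j))

end QChannel

end

namespace QChannel

/-! For `d ≥ 2`, a finite weighted unitary 2-design `(u_a, p_a)` reconstructs every trace-preserving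
unital map: identifying `X` with `Y`, `Φ(A) = ∑ p_a ((d² - 1)(q_a - 1) + 1) u_a A u_a*`, where `q_a
= ⟨v_a, J(Φ) v_a⟩` and `v_a` is the maximally entangled vector of `u_a`, with `‖v_a‖² = d`.
Unitality makes the weights sum to 1. Since `(1/d)𝟙` contributes exactly 1 to `q_a`, the norm
hypothesis gives `|q_a - 1| ≤ 1/(d² - 1)`, which is what makes the weights nonnegative.

The design comes from Haar averaging: the average of a rank-one map `B ↦ l(B) A` is unitarily
covariant, hence of the form `α B + β tr(B) 𝟙`, and two traces determine `α` and `β`. Carathéodory's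
theorem turns the Haar integral into a finite convex combination.

The ball statement follows because trace preservation, unitality and compatibility with adjoints
pass to real affine combinations. -/

/-! ### Finite averages over compact groups -/

theorem isCompact_convexHull_of_finiteDimensional {E : Type*} [NormedAddCommGroup E]
    [NormedSpace ℝ E] [FiniteDimensional ℝ E] {s : Set E} (hs : IsCompact s) :
    IsCompact (convexHull ℝ s) := by
  rcases s.eq_empty_or_nonempty with rfl | ⟨z₀, hz₀⟩
  · simp
  let n := Module.finrank ℝ E + 1
  let F : (Fin n → ℝ) × (Fin n → E) → E := fun q => ∑ i, q.1 i • q.2 i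
  have hF : Continuous F := by fun_prop
  have hK : IsCompact (F '' (stdSimplex ℝ (Fin n) ×ˢ Set.univ.pi fun _ => s)) :=
    ((isCompact_stdSimplex ℝ (Fin n)).prod (isCompact_univ_pi fun _ => hs)).image hF
  convert hK using 1
  apply Set.Subset.antisymm
  · intro x hx
    obtain ⟨ι, _, z, w, hz, hind, hw, hw1, rfl⟩ := eq_pos_convex_span_of_mem_convexHull hx
    have hcard : Fintype.card ι ≤ Fintype.card (Fin n) := by
      simpa [n] using hind.card_le_finrank_succ.trans
        (Nat.add_le_add_right (Submodule.finrank_le _) 1)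
    obtain ⟨e⟩ := Function.Embedding.nonempty_of_card_le hcard
    have hw0 : ∀ j, j ∉ Set.range e → Function.extend e w 0 j = 0 := fun j hj => by
      rw [Function.extend_apply' _ _ _ (by simpa using hj)]; rfl
    -- Carathéodory may need fewer than `n` points; spare slots get weight 0 and the dummy point
    -- `z₀`.
    refine ⟨(Function.extend e w 0, Function.extend e z fun _ => z₀), ⟨⟨fun j => ?_, ?_⟩, ?_⟩, ?_⟩
    · by_cases hj : j ∈ Set.range e
      · obtain ⟨i, rfl⟩ := hj
        simpa [e.injective.extend_apply] using (hw i).le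
      · exact (hw0 j hj).ge
    · rw [← hw1]
      exact (Fintype.sum_of_injective e e.injective w _ hw0
        fun i => (e.injective.extend_apply ..).symm).symm
    · intro j _
      by_cases hj : j ∈ Set.range e
      · obtain ⟨i, rfl⟩ := hj
        simpa [e.injective.extend_apply] using hz (Set.mem_range_self i)
      · simpa [Function.extend_apply' _ _ _ (show ¬∃ a, e a = j from hj)] using hz₀
    · refine (Fintype.sum_of_injective e e.injective _ _ (fun j hj => ?_) fun i => ?_).symm
      · simp [hw0 j hj]
      · simp [e.injective.extend_apply]
  · rintro _ ⟨⟨w, z⟩, ⟨hw, hz⟩, rfl⟩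
    exact mem_convexHull_of_exists_fintype w z hw.1 hw.2 (fun i => hz i trivial) rfl

open MeasureTheory in
/-- The average of a continuous representation of a compact group is a finite convex combination
of the values of the representation. -/
theorem exists_invariant_convex_combination {G A : Type*} [Group G] [TopologicalSpace G]
    [IsTopologicalGroup G] [CompactSpace G] [NormedRing A] [NormedAlgebra ℂ A]
    [FiniteDimensional ℂ A] (ρ : G →* A) (hρ : Continuous ρ) :
    ∃ (N : ℕ) (g : Fin N → G) (p : Fin N → ℝ), (∀ i, 0 ≤ p i) ∧ ∑ i, p i = 1 ∧
      ∀ h, ρ h * ∑ i, (p i : ℂ) • ρ (g i) = ∑ i, (p i : ℂ) • ρ (g i) := by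
  borelize G
  have : CompleteSpace A := FiniteDimensional.complete ℝ A
  let μ : Measure G := Measure.haarMeasure ⊤
  have : IsProbabilityMeasure μ := ⟨by
    simpa using Measure.haarMeasure_self (K₀ := (⊤ : TopologicalSpace.PositiveCompacts G))⟩
  have hint : Integrable ρ μ :=
    hρ.integrable_of_hasCompactSupport (HasCompactSupport.of_compactSpace _)
  have hmem : ∫ g, ρ g ∂μ ∈ convexHull ℝ (Set.range ρ) :=
    (convex_convexHull ℝ _).integral_mem
      (isCompact_convexHull_of_finiteDimensional (isCompact_range hρ)).isClosed
      (.of_forall fun g => subset_convexHull ℝ _ (Set.mem_range_self g)) hint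
  -- Left invariance of Haar measure.
  have hinv : ∀ h, ρ h * ∫ g, ρ g ∂μ = ∫ g, ρ g ∂μ := fun h => by
    rw [← integral_const_mul_of_integrable hint]
    simpa using integral_mul_left_eq_self (μ := μ) (fun g => ρ g) h
  obtain ⟨ι, _, w, z, hw, hw1, hz, hx⟩ := mem_convexHull_iff_exists_fintype.1 hmem
  choose g hg using hz
  let e := (Fintype.equivFin ι).symm
  have hsum : ∑ i, w (e i) • ρ (g (e i)) = ∫ g, ρ g ∂μ := by
    rw [e.sum_comp fun i => w i • ρ (g i), ← hx]
    simp [hg]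
  refine ⟨_, g ∘ e, w ∘ e, fun i => hw _, by simpa [e.sum_comp] using hw1, fun h => ?_⟩
  simp only [Function.comp_apply, Complex.coe_smul, hsum, hinv]

theorem compactSpace_unitary {H : Type*} [NormedAddCommGroup H] [InnerProductSpace ℂ H]
    [FiniteDimensional ℂ H] [CompleteSpace H] : CompactSpace (unitary (H →L[ℂ] H)) := by
  have : ProperSpace (H →L[ℂ] H) := FiniteDimensional.proper ℂ _
  refine isCompact_iff_compactSpace.1 (Metric.isCompact_of_isClosed_isBounded isClosed_unitary ?_)
  refine isBounded_iff_forall_norm_le.2 ⟨1, fun u hu => ?_⟩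
  exact ContinuousLinearMap.opNorm_le_bound _ zero_le_one fun x => by
    simp [ContinuousLinearMap.norm_map_of_mem_unitary hu]

/-- Conjugation by the values of a homomorphism. -/
noncomputable def conjRep {G A : Type*} [Group G] [NormedRing A] [NormedAlgebra ℂ A] (ρ : G →* A) :
    G →* (A →L[ℂ] A) where
  toFun g := ContinuousLinearMap.mulLeftRight ℂ A (ρ g) (ρ g⁻¹)
  map_one' := by ext; simp
  map_mul' g h := by ext; simp [mul_assoc]

theorem conjRep_apply {G A : Type*} [Group G] [NormedRing A] [NormedAlgebra ℂ A] (ρ : G →* A)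
    (g : G) (x : A) : conjRep ρ g x = ρ g * x * ρ g⁻¹ := rfl

theorem continuous_conjRep {G A : Type*} [Group G] [TopologicalSpace G] [IsTopologicalGroup G]
    [NormedRing A] [NormedAlgebra ℂ A] (ρ : G →* A) (hρ : Continuous ρ) :
    Continuous (conjRep ρ) := by
  change Continuous fun g => ContinuousLinearMap.mulLeftRight ℂ A (ρ g) (ρ g⁻¹)
  fun_prop

/-! ### Traces, rank-one operators and the Choi operator -/

open InnerProductSpace

variable {H X Y : Type*} [NormedAddCommGroup H] [InnerProductSpace ℂ H]
  [NormedAddCommGroup X] [InnerProductSpace ℂ X] [NormedAddCommGroup Y] [InnerProductSpace ℂ Y]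

theorem tr_eq_sum_inner {ι : Type*} [Fintype ι] (b : OrthonormalBasis ι ℂ H) (A : H →L[ℂ] H) :
    tr A = ∑ i, inner ℂ (b i) (A (b i)) :=
  LinearMap.trace_eq_sum_inner _ b

theorem tr_smul (c : ℂ) (A : H →L[ℂ] H) : tr (c • A) = c * tr A := by simp [tr]

theorem tr_add (A B : H →L[ℂ] H) : tr (A + B) = tr A + tr B := by simp [tr]

theorem tr_mul_comm (A B : H →L[ℂ] H) : tr (A * B) = tr (B * A) :=
  LinearMap.trace_mul_comm ℂ (A : H →ₗ[ℂ] H) B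

theorem tr_one [FiniteDimensional ℂ H] : tr (1 : H →L[ℂ] H) = Module.finrank ℂ H :=
  LinearMap.trace_one ℂ H

/-- The trace as a linear map. -/
noncomputable def trₗ (H : Type*) [NormedAddCommGroup H] [InnerProductSpace ℂ H] :
    (H →L[ℂ] H) →ₗ[ℂ] ℂ where
  toFun := tr
  map_add' A B := by simp [tr]
  map_smul' c A := by simp [tr]

theorem trₗ_apply (A : H →L[ℂ] H) : trₗ H A = tr A := rfl

theorem finrank_continuousLinearMap [FiniteDimensional ℂ H] :
    Module.finrank ℂ (H →L[ℂ] H) = Module.finrank ℂ H ^ 2 := by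
  rw [← (LinearMap.toContinuousLinearMap (𝕜 := ℂ) (E := H) (F' := H)).finrank_eq,
    Module.finrank_linearMap, sq]

theorem tr_rankOne [FiniteDimensional ℂ H] (x y : H) :
    tr (rankOne ℂ x y : H →L[ℂ] H) = inner ℂ y x :=
  trace_rankOne x y

theorem sum_rankOne_apply {ι : Type*} [Fintype ι] (b : OrthonormalBasis ι ℂ H) (A : H →L[ℂ] H) :
    ∑ i, rankOne ℂ (A (b i)) (b i) = A := by
  ext v
  conv_rhs => rw [← b.sum_repr' v]
  simp

theorem sum_inner_smul_rankOne {ι : Type*} [Fintype ι] (b : OrthonormalBasis ι ℂ H)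
    (A : H →L[ℂ] H) :
    ∑ i, ∑ j, inner ℂ (b i) (A (b j)) • rankOne ℂ (b i) (b j) = A := by
  rw [Finset.sum_comm]
  conv_rhs => rw [← sum_rankOne_apply b A]
  refine Finset.sum_congr rfl fun j _ => ?_
  conv_rhs => rw [← b.sum_repr' (A (b j))]
  simp [map_sum]

/-- Linear maps on operators that vanish on all rank-one positive operators vanish. -/
theorem eq_zero_of_rankOne_self [FiniteDimensional ℂ H] {D : (H →L[ℂ] H) →ₗ[ℂ] (H →L[ℂ] H)}
    (hD : ∀ v : H, D (rankOne ℂ v v) = 0) : D = 0 := by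
  have h : ∀ x y : H, D (rankOne ℂ x y) = 0 := fun x y => by
    -- Polarization: `x + y` shows that `D |x⟩⟨y|` is antisymmetric in `x, y`, and `x + iy` that it
    -- is symmetric.
    have h1 := hD (x + y)
    have h2 := hD (x + Complex.I • y)
    simp only [map_add, map_smulₛₗ, add_apply, smul_apply,
      hD, zero_add, add_zero, smul_zero, Complex.conj_I, RingHom.id_apply, neg_smul,
      map_neg] at h1 h2
    have h3 : D (rankOne ℂ y x) = D (rankOne ℂ x y) := by
      have : Complex.I • (D (rankOne ℂ y x) - D (rankOne ℂ x y)) = 0 := by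
        rw [smul_sub, sub_eq_add_neg]
        simpa [add_comm] using h2
      exact sub_eq_zero.1 ((smul_eq_zero_iff_right Complex.I_ne_zero).1 this)
    rw [h3, ← two_smul ℂ] at h1
    exact (smul_eq_zero_iff_right two_ne_zero).1 h1
  ext1 A
  rw [← sum_rankOne_apply (stdOrthonormalBasis ℂ H) A, map_sum]
  simp [h]

/-- Turns the overlaps of `Φ` with unitary conjugations into expectation values of the Choi
operator, which its operator norm controls. -/
theorem inner_choi {d : ℕ} (b : OrthonormalBasis (Fin d) ℂ X) (Φ : SuperOp X Y) (w : Fin d → Y) :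
    inner ℂ (∑ i, w i ⊗ₜ[ℂ] b i) (choi b Φ (∑ i, w i ⊗ₜ[ℂ] b i)) =
      ∑ i, ∑ j, inner ℂ (w i) (Φ (rankOne ℂ (b i) (b j)) (w j)) := by
  have h : choi b Φ (∑ i, w i ⊗ₜ[ℂ] b i) =
      ∑ i, ∑ j, (Φ (rankOne ℂ (b i) (b j)) (w j)) ⊗ₜ[ℂ] b i := by
    simp only [choi, sum_apply, map_sum, TensorProduct.mapL_tmul, rankOne_apply,
      orthonormal_iff_ite.1 b.orthonormal, ite_smul, one_smul, zero_smul, TensorProduct.tmul_ite]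
    rw [Finset.sum_comm]
    refine Finset.sum_congr rfl fun i _ => ?_
    rw [Finset.sum_comm]
    simp
  simp only [h, sum_inner, inner_sum, TensorProduct.inner_tmul,
    orthonormal_iff_ite.1 b.orthonormal, mul_ite, mul_one, mul_zero]
  refine Finset.sum_congr rfl fun i _ => ?_
  rw [Finset.sum_comm]
  simp

theorem norm_sq_sum_tmul {d : ℕ} (b : OrthonormalBasis (Fin d) ℂ X)
    (w : OrthonormalBasis (Fin d) ℂ Y) : ‖∑ i, w i ⊗ₜ[ℂ] b i‖ ^ 2 = d := by
  have : ((‖∑ i, w i ⊗ₜ[ℂ] b i‖ ^ 2 : ℝ) : ℂ) = (d : ℝ) := by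
    push_cast
    refine (inner_self_eq_norm_sq_to_K (𝕜 := ℂ) (∑ i, w i ⊗ₜ[ℂ] b i)).symm.trans ?_
    simp only [sum_inner, inner_sum, TensorProduct.inner_tmul,
      orthonormal_iff_ite.1 b.orthonormal]
    simp
  exact_mod_cast this

theorem choi_depolarizing {d : ℕ} (b : OrthonormalBasis (Fin d) ℂ X) :
    choi b (depolarizing X Y) = (1 / (d : ℂ)) • (1 : (Y ⊗[ℂ] X) →L[ℂ] (Y ⊗[ℂ] X)) := by
  have : FiniteDimensional ℂ X := b.toBasis.finiteDimensional_of_finite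
  have hfin : Module.finrank ℂ X = d := by simpa using Module.finrank_eq_card_basis b.toBasis
  have h : ∀ i j, depolarizing X Y (rankOne ℂ (b i) (b j)) =
      if i = j then (1 / (d : ℂ)) • (1 : Y →L[ℂ] Y) else 0 := fun i j => by
    change (tr (rankOne ℂ (b i) (b j)) / _) • (1 : Y →L[ℂ] Y) = _
    rw [tr_rankOne, hfin, orthonormal_iff_ite.1 b.orthonormal j i]
    rcases eq_or_ne i j with rfl | hij
    · simp
    · simp [hij, hij.symm]
  refine ContinuousLinearMap.coe_injective (TensorProduct.ext' fun y x => ?_)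
  have hx : ∑ i, inner ℂ (b i) x • b i = x := b.sum_repr' x
  simp only [choi, h, ContinuousLinearMap.coe_coe, sum_apply, TensorProduct.mapL_tmul]
  conv_rhs => rw [← hx]
  simp [ite_apply, TensorProduct.ite_tmul, TensorProduct.tmul_sum, TensorProduct.smul_tmul',
    apply_ite, smul_comm (d : ℂ)⁻¹]

theorem depolarizing_unital [FiniteDimensional ℂ X] [Nontrivial X] :
    Unital (depolarizing X Y) := by
  change (tr (1 : X →L[ℂ] X) / _) • (1 : Y →L[ℂ] Y) = _
  rw [tr_one, div_self (by exact_mod_cast Module.finrank_pos.ne'), one_smul]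

theorem depolarizing_tracePreserving [FiniteDimensional ℂ X] [FiniteDimensional ℂ Y] [Nontrivial X]
    (h : Module.finrank ℂ X = Module.finrank ℂ Y) :
    TracePreserving (depolarizing X Y) := fun A => by
  change tr ((tr A / _) • (1 : Y →L[ℂ] Y)) = _
  rw [tr_smul, tr_one, ← h, div_mul_cancel₀ _ (by exact_mod_cast Module.finrank_pos.ne')]

/-- The weights in `exists_unitary_decomposition` are nonnegative near the depolarizing map. -/
theorem exists_nonneg_weight {d : ℕ} (hd : 2 ≤ d) (b : OrthonormalBasis (Fin d) ℂ X)
    (w : OrthonormalBasis (Fin d) ℂ Y) (Φ : SuperOp X Y)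
    (hsym : (choi b Φ : Y ⊗[ℂ] X →ₗ[ℂ] Y ⊗[ℂ] X).IsSymmetric)
    (hnorm : ‖choi b Φ - (1 / (d : ℂ)) • (1 : (Y ⊗[ℂ] X) →L[ℂ] (Y ⊗[ℂ] X))‖
      ≤ 1 / ((d : ℝ) * ((d : ℝ) ^ 2 - 1))) :
    ∃ r : ℝ, 0 ≤ r ∧ (r : ℂ) = ((d : ℂ) ^ 2 - 1) *
      (∑ i, ∑ j, inner ℂ (w i) (Φ (rankOne ℂ (b i) (b j)) (w j)) - 1) + 1 := by
  set v := ∑ i, w i ⊗ₜ[ℂ] b i with hv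
  have hv2 : ‖v‖ ^ 2 = d := norm_sq_sum_tmul b w
  have hd0 : (0 : ℝ) < d := by norm_cast; omega
  have hd1 : (0 : ℝ) < (d : ℝ) ^ 2 - 1 := by
    have : (2 : ℝ) ≤ d := by exact_mod_cast hd
    nlinarith
  have hq : ∑ i, ∑ j, inner ℂ (w i) (Φ (rankOne ℂ (b i) (b j)) (w j)) =
      ((inner ℂ v (choi b Φ v)).re : ℂ) := by
    rw [← inner_choi, ← hv]
    exact (hsym.coe_re_inner_self_apply v).symm
  have hvv : inner ℂ v v = (d : ℂ) := by
    refine (inner_self_eq_norm_sq_to_K (𝕜 := ℂ) v).trans ?_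
    rw [← Complex.ofReal_natCast d, ← hv2]
    exact (Complex.ofReal_pow _ _).symm
  have hsub : inner ℂ v ((choi b Φ - (1 / (d : ℂ)) • (1 : (Y ⊗[ℂ] X) →L[ℂ] (Y ⊗[ℂ] X))) v) =
      inner ℂ v (choi b Φ v) - 1 := by
    have : (d : ℂ) ≠ 0 := by exact_mod_cast hd0.ne'
    rw [sub_apply, smul_apply, one_apply_eq_self, inner_sub_right]
    congr 1
    refine (inner_smul_right (𝕜 := ℂ) v v _).trans ?_
    rw [hvv, one_div_mul_cancel this]
  -- The factor `‖v‖² = d` cancels the `d` in the denominator of the hypothesis.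
  have hbound : |(inner ℂ v (choi b Φ v)).re - 1| ≤ 1 / ((d : ℝ) ^ 2 - 1) := by
    calc |(inner ℂ v (choi b Φ v)).re - 1| = |(inner ℂ v (choi b Φ v) - 1).re| := by simp
      _ ≤ ‖inner ℂ v (choi b Φ v) - 1‖ := Complex.abs_re_le_norm _
      _ ≤ ‖v‖ * (‖choi b Φ - (1 / (d : ℂ)) • (1 : (Y ⊗[ℂ] X) →L[ℂ] (Y ⊗[ℂ] X))‖ * ‖v‖) := by
        rw [← hsub]
        exact (norm_inner_le_norm _ _).trans
          (mul_le_mul_of_nonneg_left (ContinuousLinearMap.le_opNorm _ _) (norm_nonneg _))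
      _ = ‖choi b Φ - (1 / (d : ℂ)) • (1 : (Y ⊗[ℂ] X) →L[ℂ] (Y ⊗[ℂ] X))‖ * d := by
        rw [← hv2]; ring
      _ ≤ 1 / ((d : ℝ) * ((d : ℝ) ^ 2 - 1)) * d := mul_le_mul_of_nonneg_right hnorm hd0.le
      _ = 1 / ((d : ℝ) ^ 2 - 1) := by field_simp
  refine ⟨((d : ℝ) ^ 2 - 1) * ((inner ℂ v (choi b Φ v)).re - 1) + 1, ?_,
    by rw [hq]; push_cast; ring⟩
  have h := mul_le_mul_of_nonneg_left (abs_le.1 hbound).1 hd1.le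
  rw [mul_neg, mul_one_div_cancel hd1.ne'] at h
  linarith

/-! ### Unitarily covariant maps on operators -/

variable [CompleteSpace H] [CompleteSpace X] [CompleteSpace Y]

theorem one_sub_two_rankOne_mem_unitary {y : H} (hy : ‖y‖ = 1) :
    (1 - (2 : ℂ) • rankOne ℂ y y : H →L[ℂ] H) ∈ unitary (H →L[ℂ] H) := by
  have hs : star (1 - (2 : ℂ) • rankOne ℂ y y : H →L[ℂ] H) = 1 - (2 : ℂ) • rankOne ℂ y y := by
    simp [ContinuousLinearMap.star_eq_adjoint]
  have h1 : (1 - (2 : ℂ) • rankOne ℂ y y : H →L[ℂ] H) * (1 - (2 : ℂ) • rankOne ℂ y y) = 1 := by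
    have h2 : (rankOne ℂ y y : H →L[ℂ] H) * rankOne ℂ y y = rankOne ℂ y y :=
      isIdempotentElem_rankOne_self hy
    simp only [sub_mul, mul_sub, smul_mul_smul_comm, h2, mul_one, one_mul]
    module
  rw [Unitary.mem_iff, hs]
  exact ⟨h1, h1⟩

theorem mul_rankOne_mul_star (u : H →L[ℂ] H) (x y : H) :
    u * rankOne ℂ x y * star u = rankOne ℂ (u x) (u y) := by
  ext z
  simp [ContinuousLinearMap.star_eq_adjoint, ContinuousLinearMap.adjoint_inner_right]

theorem exists_unitary_map_eq [FiniteDimensional ℂ H] {x y : H} (hx : ‖x‖ = 1) (hy : ‖y‖ = 1) :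
    ∃ u ∈ unitary (H →L[ℂ] H), u x = y := by
  have : Nontrivial H := ⟨x, 0, by rintro rfl; simp at hx⟩
  let i : Fin (Module.finrank ℂ H) := ⟨0, Module.finrank_pos⟩
  have key : ∀ z : H, ‖z‖ = 1 →
      ∃ b : OrthonormalBasis (Fin (Module.finrank ℂ H)) ℂ H, b i = z := fun z hz => by
    obtain ⟨b, hb⟩ := Orthonormal.exists_orthonormalBasis_extension_of_card_eq (𝕜 := ℂ)
      (E := H) (by simp) (v := fun _ => z) (s := {i})
      ⟨fun _ => hz, fun j k hjk => absurd (Subsingleton.elim j k) hjk⟩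
    exact ⟨b, hb i rfl⟩
  obtain ⟨b, rfl⟩ := key x hx
  obtain ⟨c, rfl⟩ := key y hy
  refine ⟨_, (Unitary.linearIsometryEquiv.symm (b.equiv c (Equiv.refl _))).2, ?_⟩
  simp

/-- An operator commuting with all unitary operators that fix the projection onto `ℂ x`. -/
theorem eq_smul_one_add_smul_rankOne [FiniteDimensional ℂ H] {x : H} (hx : ‖x‖ = 1)
    {B : H →L[ℂ] H}
    (hB : ∀ u ∈ unitary (H →L[ℂ] H), u * rankOne ℂ x x * star u = rankOne ℂ x x →
      u * B * star u = B) :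
    ∃ β γ : ℂ, B = β • 1 + γ • rankOne ℂ x x := by
  have key : ∀ y : H, ‖y‖ = 1 → (y = x ∨ inner ℂ y x = 0) → B y = inner ℂ y (B y) • y := by
    intro y hy hyx
    -- The reflection in `y` fixes the projection onto `ℂ x`, so `B` commutes with it and preserves
    -- its `-1`-eigenspace `ℂ y`.
    have hu := one_sub_two_rankOne_mem_unitary hy
    set u : H →L[ℂ] H := 1 - (2 : ℂ) • rankOne ℂ y y with hu_def
    have hyy : inner ℂ y y = (1 : ℂ) := by simp [inner_self_eq_norm_sq_to_K, hy]
    have hcomm := hB u hu <| by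
      rw [mul_rankOne_mul_star]
      rcases hyx with rfl | h0
      · have : u y = -y := by simp [hu_def, hy, two_smul]
        simp [this]
      · have : u x = x := by simp [hu_def, h0]
        simp [this]
    have h2 : u * B = B * u := by
      rw [← hcomm, mul_assoc (u * B), Unitary.star_mul_self_of_mem hu, hcomm, mul_one]
    have h3 := congr($h2 y)
    simp only [hu_def, mul_apply_eq_comp, sub_apply,
      one_apply_eq_self, smul_apply, rankOne_apply, hyy,
      map_sub, map_smul, one_smul] at h3
    have h4 : (2 : ℂ) • B y = (2 : ℂ) • (inner ℂ y (B y) • y) := (sub_right_injective h3).symm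
    exact smul_right_injective H (two_ne_zero' ℂ) h4
  have key' : ∀ y : H, inner ℂ x y = 0 → ∃ c : ℂ, B y = c • y := by
    intro y hy
    by_cases h0 : y = 0
    · exact ⟨0, by simp [h0]⟩
    · have hn : (‖y‖ : ℂ) ≠ 0 := by simpa using h0
      have h := key ((‖y‖ : ℂ)⁻¹ • y) (by simp [norm_smul, h0])
        (.inr (by rw [inner_smul_left, inner_eq_zero_symm.1 hy, mul_zero]))
      rw [map_smul, smul_comm] at h
      exact ⟨_, smul_right_injective H (inv_ne_zero hn) h⟩
  let W : Submodule ℂ H := (ℂ ∙ x)ᗮ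
  have hW : ∀ y ∈ W, (B : H →ₗ[ℂ] H) y ∈ W := fun y hy => by
    obtain ⟨c, hc⟩ := key' y (Submodule.mem_orthogonal_singleton_iff_inner_right.1 hy)
    simpa [hc] using W.smul_mem c hy
  -- Every vector of `W` is an eigenvector of `B`, so `B` is a scalar there.
  obtain ⟨β, hβ⟩ := LinearMap.exists_eq_smul_id_of_forall_notLinearIndependent
    (f := (B : H →ₗ[ℂ] H).restrict hW) fun v hv => by
      obtain ⟨c, hc⟩ := key' v (Submodule.mem_orthogonal_singleton_iff_inner_right.1 v.2)
      rw [LinearIndependent.pair_iff] at hv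
      have := hv c (-1) (by ext; simp [hc])
      simp at this
  refine ⟨β, inner ℂ x (B x) - β, ?_⟩
  ext v
  have hxx : inner ℂ x x = (1 : ℂ) := by simp [inner_self_eq_norm_sq_to_K, hx]
  have hv : v - inner ℂ x v • x ∈ W := by
    rw [Submodule.mem_orthogonal_singleton_iff_inner_right, inner_sub_right, inner_smul_right, hxx]
    simp
  have h1 : B (v - inner ℂ x v • x) = β • (v - inner ℂ x v • x) := by
    simpa using congr((($hβ ⟨_, hv⟩ : W) : H))
  rw [map_sub, map_smul, key x hx (.inl rfl), sub_eq_iff_eq_add] at h1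
  simp only [add_apply, smul_apply,
    one_apply_eq_self, rankOne_apply, h1]
  module

/-- The unitarily covariant maps are spanned by the identity and the depolarizing map. -/
theorem exists_eq_smul_add_tr_smul_one [FiniteDimensional ℂ H]
    {R : (H →L[ℂ] H) →ₗ[ℂ] (H →L[ℂ] H)}
    (hR : ∀ u ∈ unitary (H →L[ℂ] H), ∀ A, R (u * A * star u) = u * R A * star u) :
    ∃ α β : ℂ, ∀ A, R A = α • A + (β * tr A) • 1 := by
  rcases subsingleton_or_nontrivial H with hH | hH
  · exact ⟨0, 0, fun A => Subsingleton.elim _ _⟩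
  obtain ⟨x₀, hx₀⟩ := exists_norm_eq H zero_le_one
  obtain ⟨β, α, h₀⟩ := eq_smul_one_add_smul_rankOne (B := R (rankOne ℂ x₀ x₀)) hx₀
    fun u hu h => by rw [← hR u hu, h]
  refine ⟨α, β, fun A => ?_⟩
  suffices R - (α • LinearMap.id + β • (trₗ H).smulRight 1) = 0 by
    simpa [smul_smul, trₗ_apply] using congr($(sub_eq_zero.1 this) A)
  -- Unitaries act transitively on unit vectors, so the coefficients found at `x₀` serve for all.
  have h₁ : ∀ x : H, ‖x‖ = 1 → R (rankOne ℂ x x) = β • 1 + α • rankOne ℂ x x := fun x hx => by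
    obtain ⟨u, hu, rfl⟩ := exists_unitary_map_eq hx₀ hx
    rw [← mul_rankOne_mul_star, hR u hu, h₀]
    simp [mul_add, add_mul, Unitary.mul_star_self_of_mem hu]
  refine eq_zero_of_rankOne_self fun v => ?_
  by_cases hv : v = 0
  · simp [hv]
  have hn : (‖v‖ : ℂ) ≠ 0 := by simpa using hv
  obtain ⟨w, hw, hvw⟩ : ∃ w : H, ‖w‖ = 1 ∧ v = (‖v‖ : ℂ) • w :=
    ⟨(‖v‖ : ℂ)⁻¹ • v, by simp [norm_smul, hv], by simp [smul_smul, hn]⟩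
  rw [hvw]
  simp only [map_smulₛₗ, smul_apply]
  simp [h₁ w hw, trₗ_apply, tr_rankOne, inner_self_eq_norm_sq_to_K, hw, add_comm]

/-! ### The unitary design and the reconstruction formula -/

/-- A finite weighted unitary 2-design, through its action on operators. -/
theorem exists_unitary_design (H : Type*) [NormedAddCommGroup H] [InnerProductSpace ℂ H]
    [CompleteSpace H] [FiniteDimensional ℂ H] :
    ∃ (N : ℕ) (u : Fin N → unitary (H →L[ℂ] H)) (p : Fin N → ℝ), (∀ i, 0 ≤ p i) ∧ ∑ i, p i = 1 ∧
      ∀ (l : (H →L[ℂ] H) →ₗ[ℂ] ℂ) (A : H →L[ℂ] H), ∃ α β : ℂ,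
        (∀ B, ∑ i, (p i : ℂ) • l (star (u i : H →L[ℂ] H) * B * u i) •
          ((u i : H →L[ℂ] H) * A * star (u i : H →L[ℂ] H)) = α • B + (β * tr B) • 1) ∧
        α * (Module.finrank ℂ H : ℂ) ^ 2 + β * Module.finrank ℂ H = l A ∧
        α * Module.finrank ℂ H + β * (Module.finrank ℂ H : ℂ) ^ 2 = l 1 * tr A := by
  have := compactSpace_unitary (H := H)
  let Ad := conjRep (unitary (H →L[ℂ] H)).subtype
  have hAd : Continuous Ad := continuous_conjRep _ continuous_subtype_val
  have Ad_apply : ∀ u A, Ad u A = u * A * star (u : H →L[ℂ] H) := fun _ _ => rfl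
  -- Averaging the action on maps of operators, before any map is chosen, gives one design that
  -- works for all `l` and `A`.
  obtain ⟨N, u, p, hp, hp1, hinv⟩ :=
    exists_invariant_convex_combination
      (A := ((H →L[ℂ] H) →L[ℂ] (H →L[ℂ] H)) →L[ℂ] ((H →L[ℂ] H) →L[ℂ] (H →L[ℂ] H)))
      (conjRep Ad) (continuous_conjRep Ad hAd)
  refine ⟨N, u, p, hp, hp1, fun l A => ?_⟩
  let R : (H →L[ℂ] H) →L[ℂ] (H →L[ℂ] H) :=
    LinearMap.toContinuousLinearMap (l.smulRight A)
  let T := (∑ i, (p i : ℂ) • conjRep Ad (u i)) R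
  have hT : ∀ B, T B = ∑ i, (p i : ℂ) • l (star (u i : H →L[ℂ] H) * B * u i) •
      ((u i : H →L[ℂ] H) * A * star (u i : H →L[ℂ] H)) := fun B => by
    simp only [T, sum_apply, smul_apply, conjRep_apply,
      mul_apply_eq_comp, Ad_apply, R, LinearMap.coe_toContinuousLinearMap',
      LinearMap.smulRight_apply, ← Unitary.star_eq_inv, Unitary.coe_star, star_star,
      mul_smul_comm, smul_mul_assoc]
  have hcomm : ∀ v ∈ unitary (H →L[ℂ] H), ∀ B, T (v * B * star v) = v * T B * star v := by
    intro v hv B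
    have h1 : conjRep Ad ⟨v, hv⟩ T = T := congr($(hinv ⟨v, hv⟩) R)
    conv_lhs => rw [← h1]
    have h2 : Ad ⟨v, hv⟩⁻¹ (v * B * star v) = B := by
      change Ad ⟨v, hv⟩⁻¹ (Ad ⟨v, hv⟩ B) = B
      rw [← mul_apply_eq_comp, ← map_mul]
      simp
    rw [conjRep_apply, mul_apply_eq_comp, mul_apply_eq_comp, h2, Ad_apply]
  obtain ⟨α, β, h⟩ := exists_eq_smul_add_tr_smul_one
    (R := (T : (H →L[ℂ] H) →ₗ[ℂ] (H →L[ℂ] H))) hcomm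
  have hp1' : ∑ i, (p i : ℂ) = 1 := by exact_mod_cast hp1
  refine ⟨α, β, fun B => (hT B).symm.trans (h B), ?_, ?_⟩
  -- First equation: the trace of `T` on the `d²`-dimensional operator space. Each conjugate of `R`
  -- has trace `l A`.
  · have e1 : (T : (H →L[ℂ] H) →ₗ[ℂ] (H →L[ℂ] H)) =
        α • LinearMap.id + β • (trₗ H).smulRight 1 := by
      ext1 B
      simpa [smul_smul, trₗ_apply] using h B
    have e2 : (T : (H →L[ℂ] H) →ₗ[ℂ] (H →L[ℂ] H)) = ∑ i, (p i : ℂ) •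
        (l ∘ₗ LinearMap.mulLeftRight ℂ (star (u i : H →L[ℂ] H), (u i : H →L[ℂ] H))).smulRight
          ((u i : H →L[ℂ] H) * A * star (u i : H →L[ℂ] H)) := by
      ext1 B
      simpa using hT B
    have e3 := congrArg (LinearMap.trace ℂ (H →L[ℂ] H)) (e1.symm.trans e2)
    have e4 : ∀ i, star (u i : H →L[ℂ] H) * (u i * A * star (u i : H →L[ℂ] H)) * u i = A :=
      fun i => by
        rw [mul_assoc (u i : H →L[ℂ] H), ← mul_assoc, ← mul_assoc,
          Unitary.coe_star_mul_self, one_mul, mul_assoc, Unitary.coe_star_mul_self, mul_one]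
    simpa [e4, trₗ_apply, tr_one, finrank_continuousLinearMap, ← Finset.sum_mul, hp1'] using e3
  -- Second equation: the trace of the operator `T 1`.
  · have e1 := congrArg tr ((hT 1).symm.trans (h 1))
    rw [tr_add, tr_smul, tr_smul, tr_one] at e1
    rw [← trₗ_apply, map_sum] at e1
    have e4 : ∀ i, tr ((u i : H →L[ℂ] H) * A * star (u i : H →L[ℂ] H)) = tr A := fun i => by
      rw [tr_mul_comm, ← mul_assoc, Unitary.coe_star_mul_self, one_mul]
    simp only [map_smul, trₗ_apply, mul_one, Unitary.coe_star_mul_self, e4, smul_eq_mul,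
      ← Finset.sum_mul, hp1', one_mul] at e1
    rw [e1]
    ring

/-- The overlap of the super-operator `Ψ` with the conjugation by `u`. -/
noncomputable def overlap {ι : Type*} [Fintype ι] (c : ι → H) (Ψ : SuperOp H H)
    (u : H →L[ℂ] H) : ℂ :=
  ∑ i, ∑ j, inner ℂ (u (c i)) (Ψ (rankOne ℂ (c i) (c j)) (u (c j)))

/-- Averaging `u A u*` over the design gives `(tr A / d) 𝟙`; weighting by the overlap gives `(d² -
1)⁻¹ (Ψ A - (tr A / d) 𝟙) + (tr A / d) 𝟙`. The stated weight is the combination of the two that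
leaves `Ψ A`. -/
theorem exists_unitary_decomposition {d : ℕ} (hd : 2 ≤ d) (c : OrthonormalBasis (Fin d) ℂ H)
    (Ψ : SuperOp H H) (htr : TracePreserving Ψ) (h1 : Unital Ψ) :
    ∃ (N : ℕ) (u : Fin N → unitary (H →L[ℂ] H)) (p : Fin N → ℝ), (∀ i, 0 ≤ p i) ∧
      ∀ A, Ψ A = ∑ a, ((p a : ℂ) * (((d : ℂ) ^ 2 - 1) * (overlap c Ψ (u a) - 1) + 1)) •
        ((u a : H →L[ℂ] H) * A * star (u a : H →L[ℂ] H)) := by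
  have : FiniteDimensional ℂ H := c.toBasis.finiteDimensional_of_finite
  have hfin : Module.finrank ℂ H = d := by simpa using Module.finrank_eq_card_basis c.toBasis
  obtain ⟨N, u, p, hp, hp1, hdes⟩ := exists_unitary_design H
  rw [hfin] at hdes
  refine ⟨N, u, p, hp, fun A => ?_⟩
  have hd0 : (d : ℂ) ≠ 0 := by norm_cast; omega
  have hd1 : (d : ℂ) ^ 2 - 1 ≠ 0 := by
    rw [sub_ne_zero]; norm_cast; nlinarith
  have hone : tr (1 : H →L[ℂ] H) = d := by rw [tr_one, hfin]
  set S : Fin N → (H →L[ℂ] H) := fun a => (u a : H →L[ℂ] H) * A * star (u a : H →L[ℂ] H) with hS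
  have hmean : ∑ a, (p a : ℂ) • S a = (tr A / d) • (1 : H →L[ℂ] H) := by
    obtain ⟨α, β, h, e1, e2⟩ := hdes (trₗ H) A
    rw [trₗ_apply] at e1 e2
    have hα : α = 0 := by
      have : α * ((d : ℂ) * (d ^ 2 - 1)) = 0 := by
        rw [hone] at e2
        linear_combination d * e1 - e2
      simpa [hd0, hd1] using this
    have hβ : β * d = tr A := by simpa [hα] using e1
    have h2 := h 1
    simp only [mul_one, Unitary.coe_star_mul_self, trₗ_apply, hone, hα, zero_smul, zero_add,
      hβ] at h2
    rw [div_eq_inv_mul, mul_smul, ← h2, Finset.smul_sum]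
    refine Finset.sum_congr rfl fun a _ => ?_
    rw [smul_comm (p a : ℂ), inv_smul_smul₀ hd0]
  let l : Fin d → Fin d → (H →L[ℂ] H) →ₗ[ℂ] ℂ := fun i j =>
    { toFun B := inner ℂ (c i) (B (c j))
      map_add' B C := by simp
      map_smul' z B := by simp }
  have hl : ∀ i j B, l i j B = inner ℂ (c i) (B (c j)) := fun _ _ _ => rfl
  choose α β h e1 e2 using fun i j => hdes (l i j) A
  have hl1 : ∀ i j, l i j 1 = if i = j then 1 else 0 := fun i j => by
    simp [hl, orthonormal_iff_ite.1 c.orthonormal i j]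
  have hα : ∀ i j, ((d : ℂ) ^ 2 - 1) * α i j = l i j A - l i j 1 * (tr A / d) := fun i j => by
    field_simp
    linear_combination d * e1 i j - e2 i j
  -- Trace preservation enters here, making the `β` terms collapse to `tr A / d`.
  have htrE : ∀ i j, tr (Ψ (rankOne ℂ (c i) (c j))) = l i j 1 := fun i j => by
    rw [htr, tr_rankOne, hl1, orthonormal_iff_ite.1 c.orthonormal j i]
    simp [eq_comm]
  have hβ : ∑ i, ∑ j, β i j * l i j 1 = tr A / d := by
    simp only [hl1, mul_ite, mul_one, mul_zero, Finset.sum_ite_eq, Finset.mem_univ, if_true]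
    have hs : ∑ i, α i i = 0 := by
      have : ((d : ℂ) ^ 2 - 1) * ∑ i, α i i = 0 := by
        rw [Finset.mul_sum]
        simp only [hα, hl1, if_true, Finset.sum_sub_distrib, hl, ← tr_eq_sum_inner]
        simp [mul_div_cancel₀, hd0]
      simpa [hd1] using this
    have hb : ∑ i, (α i i * (d : ℂ) ^ 2 + β i i * d) = tr A := by
      simp only [e1, hl, ← tr_eq_sum_inner]
    rw [Finset.sum_add_distrib, ← Finset.sum_mul, ← Finset.sum_mul, hs, zero_mul, zero_add] at hb
    rw [← hb, mul_div_cancel_right₀ _ hd0]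
  -- Up to `d² - 1`, the `α i j` are the matrix entries of the traceless part of `A`; unitality lets
  -- `Ψ` fix the scalar part.
  have hαΨ : ((d : ℂ) ^ 2 - 1) • ∑ i, ∑ j, α i j • Ψ (rankOne ℂ (c i) (c j)) =
      Ψ A - (tr A / d) • 1 := by
    conv_rhs => rw [← h1, ← map_smul, ← map_sub, ← sum_inner_smul_rankOne c (A - (tr A / d) • 1)]
    simp only [Finset.smul_sum, map_sum, map_smul, smul_smul, hα]
    refine Finset.sum_congr rfl fun i _ => Finset.sum_congr rfl fun j _ => ?_
    congr 1
    simp [hl, mul_comm]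
  have hover : ∑ a, ((p a : ℂ) * overlap c Ψ (u a)) • S a =
      (∑ i, ∑ j, α i j • Ψ (rankOne ℂ (c i) (c j))) + (tr A / d) • 1 := by
    have hq : ∀ a, overlap c Ψ (u a) = ∑ i, ∑ j, l i j (star (u a : H →L[ℂ] H) *
        Ψ (rankOne ℂ (c i) (c j)) * u a) := fun a => by
      simp [overlap, hl, ContinuousLinearMap.star_eq_adjoint,
        ContinuousLinearMap.adjoint_inner_right]
    rw [← hβ]
    simp only [Finset.sum_smul, ← Finset.sum_add_distrib, hq, Finset.mul_sum, ← htrE, ← h, hS]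
    rw [Finset.sum_comm]
    refine Finset.sum_congr rfl fun i _ => ?_
    rw [Finset.sum_comm]
    exact Finset.sum_congr rfl fun j _ => Finset.sum_congr rfl fun a _ => mul_smul _ _ _
  have expand : ∀ a, ((p a : ℂ) * (((d : ℂ) ^ 2 - 1) * (overlap c Ψ (u a) - 1) + 1)) • S a =
      ((d : ℂ) ^ 2 - 1) • (((p a : ℂ) * overlap c Ψ (u a)) • S a) +
        (2 - (d : ℂ) ^ 2) • ((p a : ℂ) • S a) := fun a => by module
  symm
  calc _ = ∑ a, (((d : ℂ) ^ 2 - 1) • (((p a : ℂ) * overlap c Ψ (u a)) • S a) +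
        (2 - (d : ℂ) ^ 2) • ((p a : ℂ) • S a)) := Finset.sum_congr rfl fun a _ => expand a
    _ = Ψ A := by
      rw [Finset.sum_add_distrib, ← Finset.smul_sum, ← Finset.smul_sum, hover, hmean, smul_add, hαΨ]
      module

/-! ### Mixed-unitary decompositions from `X` to `Y` -/

theorem conj_eq_conjStarAlgEquiv (U : X ≃ₗᵢ[ℂ] Y) (A : X →L[ℂ] X) :
    (U : X →L[ℂ] Y) ∘L A ∘L ContinuousLinearMap.adjoint (U : X →L[ℂ] Y) =
      U.conjStarAlgEquiv A := by
  rw [U.conjStarAlgEquiv_apply, U.adjoint_eq_symm]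

theorem mixedUnitary_of_norm_choi_sub_le {d : ℕ} (hd : 2 ≤ d) (b : OrthonormalBasis (Fin d) ℂ X)
    (c : OrthonormalBasis (Fin d) ℂ Y) (Φ : SuperOp X Y) (htr : TracePreserving Φ) (h1 : Unital Φ)
    (hsym : (choi b Φ : Y ⊗[ℂ] X →ₗ[ℂ] Y ⊗[ℂ] X).IsSymmetric)
    (hnorm : ‖choi b Φ - (1 / (d : ℂ)) • (1 : (Y ⊗[ℂ] X) →L[ℂ] (Y ⊗[ℂ] X))‖
      ≤ 1 / ((d : ℝ) * ((d : ℝ) ^ 2 - 1))) :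
    MixedUnitary Φ := by
  let e : X ≃ₗᵢ[ℂ] Y := b.equiv c (Equiv.refl _)
  have he : ∀ i, e.symm (c i) = b i := fun i => by
    rw [LinearIsometryEquiv.symm_apply_eq]; simp [e]
  let Ψ : SuperOp Y Y := Φ ∘ₗ (e.symm.conjStarAlgEquiv.toAlgEquiv.toLinearMap)
  have hΨ : ∀ B, Ψ B = Φ (e.symm.conjStarAlgEquiv B) := fun _ => rfl
  have htr' : TracePreserving Ψ := fun B => by
    rw [hΨ, htr, tr, tr]
    exact LinearMap.trace_conj' (B : Y →ₗ[ℂ] Y) e.symm.toLinearEquiv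
  have h1' : Unital Ψ := by rw [Unital, hΨ, map_one, h1]
  obtain ⟨N, u, p, hp, hdec⟩ := exists_unitary_decomposition hd c Ψ htr' h1'
  have hE : ∀ i j, Ψ (rankOne ℂ (c i) (c j)) = Φ (rankOne ℂ (b i) (b j)) := fun i j => by
    rw [hΨ]
    congr 1
    ext x
    simp [← he, e.symm.inner_map_eq_flip]
  have hw : ∀ a, ∃ r : ℝ, 0 ≤ r ∧ (r : ℂ) =
      ((d : ℂ) ^ 2 - 1) * (overlap c Ψ (u a) - 1) + 1 := fun a => by
    simp only [overlap, hE]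
    exact exists_nonneg_weight hd b
      (c.map (Unitary.linearIsometryEquiv (u a))) Φ hsym hnorm
  choose r hr0 hr using hw
  have hdec' : ∀ A, Φ A = ∑ a, ((p a * r a : ℝ) : ℂ) •
      (e.trans (Unitary.linearIsometryEquiv (u a))).conjStarAlgEquiv A := fun A => by
    have := hdec (e.conjStarAlgEquiv A)
    rw [hΨ, ← LinearIsometryEquiv.symm_conjStarAlgEquiv, StarAlgEquiv.symm_apply_apply] at this
    rw [this]
    refine Finset.sum_congr rfl fun a _ => ?_
    rw [← hr]
    push_cast
    rfl
  have : Nontrivial (Y →L[ℂ] Y) := by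
    have : Nontrivial Y := ⟨c ⟨0, by omega⟩, 0, c.orthonormal.ne_zero _⟩
    infer_instance
  refine ⟨N, fun a => e.trans (Unitary.linearIsometryEquiv (u a)), fun a => p a * r a,
    fun a => mul_nonneg (hp a) (hr0 a), ?_, fun A => ?_⟩
  -- Evaluating the decomposition at `𝟙` shows that the weights sum to 1.
  · have h := hdec' 1
    simp only [map_one, ← Finset.sum_smul] at h
    rw [h1] at h
    have h2 : (1 : ℂ) = ∑ a, ((p a * r a : ℝ) : ℂ) :=
      smul_left_injective ℂ (one_ne_zero' (Y →L[ℂ] Y)) (by simpa using h)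
    exact_mod_cast h2.symm
  · simp only [conj_eq_conjStarAlgEquiv, hdec']

/-- In dimension at most one every unital super-operator is mixed-unitary. -/
theorem mixedUnitary_of_unital {d : ℕ} (hd : d ≤ 1) (b : OrthonormalBasis (Fin d) ℂ X)
    (c : OrthonormalBasis (Fin d) ℂ Y) (Φ : SuperOp X Y) (h1 : Unital Φ) : MixedUnitary Φ := by
  have hscalar : ∀ A : X →L[ℂ] X, ∃ z : ℂ, A = z • 1 := fun A => by
    have : FiniteDimensional ℂ X := b.toBasis.finiteDimensional_of_finite
    have hfin : Module.finrank ℂ X = d := by simpa using Module.finrank_eq_card_basis b.toBasis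
    obtain rfl | rfl : d = 0 ∨ d = 1 := by omega
    · have : Subsingleton X := Module.finrank_zero_iff.1 hfin
      exact ⟨0, Subsingleton.elim _ _⟩
    · obtain ⟨z, hz, -⟩ := LinearMap.existsUnique_eq_smul_id_of_finrank_eq_one hfin (A : X →ₗ[ℂ] X)
      exact ⟨z, by ext x; simpa using congr($hz x)⟩
  refine ⟨1, fun _ => b.equiv c (Equiv.refl _), fun _ => 1, by simp, by simp, fun A => ?_⟩
  obtain ⟨z, rfl⟩ := hscalar A
  simp only [conj_eq_conjStarAlgEquiv]
  simp only [map_smul, map_one, show Φ 1 = 1 from h1]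
  simp

/-! ### The affine span of the doubly stochastic channels -/

theorem CompletelyPositive.map_star {Φ : SuperOp X Y} (h : CompletelyPositive Φ)
    (A : X →L[ℂ] X) : Φ (star A) = star (Φ A) := by
  obtain ⟨F, rfl⟩ := h
  exact StarHomClass.map_star F A

theorem isSymmetric_choi [FiniteDimensional ℂ X] [FiniteDimensional ℂ Y] {d : ℕ}
    (b : OrthonormalBasis (Fin d) ℂ X) {Φ : SuperOp X Y} (h : ∀ A, Φ (star A) = star (Φ A)) :
    (choi b Φ : Y ⊗[ℂ] X →ₗ[ℂ] Y ⊗[ℂ] X).IsSymmetric := by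
  have : CompleteSpace (Y ⊗[ℂ] X) := FiniteDimensional.complete ℂ _
  rw [← ContinuousLinearMap.isSelfAdjoint_iff_isSymmetric, isSelfAdjoint_iff]
  rw [choi, star_sum, Finset.sum_comm]
  refine Finset.sum_congr rfl fun i _ => ?_
  rw [star_sum]
  refine Finset.sum_congr rfl fun j _ => ?_
  rw [ContinuousLinearMap.star_eq_adjoint, TensorProduct.adjoint_mapL, adjoint_rankOne,
    ← ContinuousLinearMap.star_eq_adjoint, ← h, ContinuousLinearMap.star_eq_adjoint,
    adjoint_rankOne]

theorem DoublyStochastic.conjStarAlgEquiv (U : X ≃ₗᵢ[ℂ] Y) :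
    DoublyStochastic (U.conjStarAlgEquiv.toAlgEquiv.toLinearMap : SuperOp X Y) := by
  refine ⟨⟨CompletelyPositiveMapClass.toCompletelyPositiveLinearMap U.conjStarAlgEquiv, rfl⟩,
    fun A => ?_, map_one U.conjStarAlgEquiv⟩
  exact LinearMap.trace_conj' (A : X →ₗ[ℂ] X) U.toLinearEquiv

theorem MixedUnitary.mem_affineSpan {Φ : SuperOp X Y} (h : MixedUnitary Φ) :
    Φ ∈ affineSpan ℝ {Ψ : SuperOp X Y | DoublyStochastic Ψ} := by
  obtain ⟨N, U, p, hp, hp1, hΦ⟩ := h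
  refine convexHull_subset_affineSpan _ (mem_convexHull_of_exists_fintype p
    (fun i => ((U i).conjStarAlgEquiv.toAlgEquiv.toLinearMap : SuperOp X Y)) hp hp1
    (fun i => DoublyStochastic.conjStarAlgEquiv (U i)) ?_)
  ext1 A
  rw [hΦ]
  simp only [conj_eq_conjStarAlgEquiv, LinearMap.sum_apply, LinearMap.smul_apply, Complex.coe_smul]
  rfl

theorem depolarizing_star [FiniteDimensional ℂ X] (A : X →L[ℂ] X) :
    depolarizing X Y (star A) = star (depolarizing X Y A) := by
  have h : tr (star A) = star (tr A) := by
    simp [tr_eq_sum_inner (stdOrthonormalBasis ℂ X), ContinuousLinearMap.star_eq_adjoint,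
      ContinuousLinearMap.adjoint_inner_right]
  change (tr (star A) / _) • (1 : Y →L[ℂ] Y) = star ((tr A / _) • (1 : Y →L[ℂ] Y))
  simp [h]

theorem hermitian_of_mem_affineSpan {Φ : SuperOp X Y}
    (h : Φ ∈ affineSpan ℝ {Ψ : SuperOp X Y | DoublyStochastic Ψ}) :
    TracePreserving Φ ∧ Unital Φ ∧ ∀ A, Φ (star A) = star (Φ A) := by
  refine affineSpan_induction h (fun Ψ hΨ => ⟨hΨ.2.1, hΨ.2.2, hΨ.1.map_star⟩) ?_
  rintro r u v w ⟨hu, hu1, hus⟩ ⟨hv, hv1, hvs⟩ ⟨hw, hw1, hws⟩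
  -- The coefficient `r` is real, so compatibility with `star` survives.
  have key : ∀ A, (r • (u -ᵥ v) +ᵥ w) A = (r : ℂ) • (u A - v A) + w A := fun A => by
    simp
  refine ⟨fun A => ?_, ?_, fun A => ?_⟩
  · rw [key, tr_add, tr_smul, ← trₗ_apply (_ - _), map_sub, trₗ_apply, trₗ_apply, hu, hv, hw]
    simp
  · rw [Unital, key, hu1, hv1, hw1]
    simp
  · simp [hus, hvs, hws]

end QChannel

theorem mainTheorem2 {X Y : Type*}
    [NormedAddCommGroup X] [InnerProductSpace ℂ X] [CompleteSpace X]
    [NormedAddCommGroup Y] [InnerProductSpace ℂ Y] [CompleteSpace Y] [FiniteDimensional ℂ Y]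
    (d : ℕ) (b : OrthonormalBasis (Fin d) ℂ X) (hY : Module.finrank ℂ Y = d) :
    (∀ Φ : QChannel.SuperOp X Y,
      QChannel.TracePreserving Φ → QChannel.Unital Φ →
      (QChannel.choi b Φ : Y ⊗[ℂ] X →ₗ[ℂ] Y ⊗[ℂ] X).IsSymmetric →
      ‖QChannel.choi b Φ - (1 / (d : ℂ)) • (1 : (Y ⊗[ℂ] X) →L[ℂ] (Y ⊗[ℂ] X))‖
        ≤ 1 / ((d : ℝ) * ((d : ℝ) ^ 2 - 1)) →
      QChannel.MixedUnitary Φ) ∧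
    (QChannel.depolarizing X Y ∈
        affineSpan ℝ {Ψ : QChannel.SuperOp X Y | QChannel.DoublyStochastic Ψ} ∧
      ∃ r : ℝ, 0 < r ∧
        ∀ Φ ∈ affineSpan ℝ {Ψ : QChannel.SuperOp X Y | QChannel.DoublyStochastic Ψ},
          ‖QChannel.choi b Φ - QChannel.choi b (QChannel.depolarizing X Y)‖ ≤ r →
          QChannel.MixedUnitary Φ) := by
  have : FiniteDimensional ℂ X := b.toBasis.finiteDimensional_of_finite
  have hX : Module.finrank ℂ X = d := by simpa using Module.finrank_eq_card_basis b.toBasis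
  let c : OrthonormalBasis (Fin d) ℂ Y := (stdOrthonormalBasis ℂ Y).reindex (finCongr hY)
  rcases Nat.lt_or_ge d 2 with hd | hd
  -- Here `d² - 1` cannot be inverted (or `d = 0`), but all operators are scalars, so unitality
  -- alone suffices and the radius 1 is arbitrary.
  · have hd1 : d ≤ 1 := by omega
    have hmixed := fun Φ h => QChannel.mixedUnitary_of_unital hd1 b c Φ h
    refine ⟨fun Φ _ h _ _ => hmixed Φ h, (hmixed _ ?_).mem_affineSpan, 1, one_pos,
      fun Φ hΦ _ => hmixed Φ (QChannel.hermitian_of_mem_affineSpan hΦ).2.1⟩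
    rcases subsingleton_or_nontrivial X with hX0 | hX0
    · have : Subsingleton Y := c.toBasis.repr.toEquiv.trans
        (b.toBasis.repr.toEquiv.symm) |>.subsingleton
      exact Subsingleton.elim _ _
    · exact QChannel.depolarizing_unital
  · have hmixed := fun Φ => QChannel.mixedUnitary_of_norm_choi_sub_le hd b c Φ
    have hr : (0 : ℝ) < 1 / ((d : ℝ) * ((d : ℝ) ^ 2 - 1)) := by
      have : (2 : ℝ) ≤ d := by exact_mod_cast hd
      have : (0 : ℝ) < (d : ℝ) ^ 2 - 1 := by nlinarith
      positivity
    have : Nontrivial X := Module.nontrivial_of_finrank_pos (R := ℂ) (by omega)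
    -- The first claim applied to `Ω` itself, at distance 0, makes it a convex combination of
    -- unitary conjugations, which are doubly stochastic.
    refine ⟨hmixed, (hmixed _ (QChannel.depolarizing_tracePreserving (hX.trans hY.symm))
      QChannel.depolarizing_unital (QChannel.isSymmetric_choi b QChannel.depolarizing_star)
      ?_).mem_affineSpan, _, hr, fun Φ hΦ hn => ?_⟩
    · rw [QChannel.choi_depolarizing, sub_self]
      exact ContinuousLinearMap.opNorm_zero.trans_le hr.le
    · obtain ⟨h1, h2, h3⟩ := QChannel.hermitian_of_mem_affineSpan hΦ
      rw [QChannel.choi_depolarizing] at hn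
      exact hmixed Φ h1 h2 (QChannel.isSymmetric_choi b h3) hn
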